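/- **Setting.** Consider a game with $T$ stages between a principal $A$ and a receiver $B$. For each stage $t$ there are finite non-empty state and action sets $\mathcal X_t,\mathcal U_t$ and a finite outcome set $\mathcal M_t$; $\Delta(\cdot)$ denotes the set of probability distributions. The initial state $X_1$ has law $\hat\pi\in\Delta(\mathcal X_1)$. At stage $t$: (1) the principal publicly chooses an experiment $\sigma_t\in\mathcal S_t$, i.e. a kernel $\sigma_t:\mathcal X_t\to\Delta(\mathcal M_t)$; (2) an outcome $M_t\sim\sigma_t(\cdot\mid X_t)$ is publicly revealed; (3) the receiver publicly chooses $U_t\in\mathcal U_t$; (4) $X_{t+1}\sim P_t(\cdot\mid X_t,U_t)$. Nobody observes the states. Histories are $h_t^A=(\sigma_{1:t-1},m_{1:t-1},u_{1:t-1})$ and $h_t^B=(\sigma_{1:t},m_{1:t},u_{1:t-1})$; pure strategies are maps $g_t^A:h_t^A\mapsto\sigma_t$ and $g_t^B:h_t^B\mapsto u_t$; payoffs are $J^i(g)=\mathbb E^g[\sum_{t=1}^T r_t^i(X_t,U_t)]$, $i\in\{A,B\}$. A *belief system* $\mu$ assigns to each history $h_t^i$ a distribution $\mu_t^i(\cdot\mid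 h_t^i)$ of $X_{1:t}$. A pair $(g,\mu)$ is a *Perfect Bayesian Equilibrium* (PBE) if (a) $g$ is sequentially rational given $\mu$: at every history $h_t^i$, $t\le T$, on or off the path of play, no other strategy of player $i$ gives a larger expectation of $\sum_{s=t}^T r_s^i(X_s,U_s)$, when $X_{1:t}$ has law $\mu_t^i(\cdot\mid h_t^i)$ and the opponent plays according to $g$; and (b) $\mu$ obeys Bayes' law whenever the denominator is non-zero: $\mu_t^i(\cdot\mid h_t^i)$ is the conditional law of $X_{1:t}$ under $g$ at every $h_t^i$ of positive probability; and, for all histories, $\mu_1^A=\hat\pi$, $\mu_t^B(x_{1:t}\mid h_t^A,\sigma_t,m_t)=\mu_t^A(x_{1:t}\mid h_t^A)\sigma_t(m_t\mid x_t)\big/\sum_{\tilde x_{1:t}}\mu_t^A(\tilde x_{1:t}\mid h_t^A)\sigma_t(m_t\mid\tilde x_t)$ if the denominator is non-zero, and $\mu_{t+1}^A(x_{1:t+1}\mid h_t^B,u_t)=\mu_t^B(x_{1:t}\mid h_t^B)P_t(x_{t+1}\mid x_t,u_t)$ for $t<T$. For $\pi_t\in\Delta(\mathcal X_t)$ put $\ell_t(\pi_t,u_t)(x_{t+1})=\sum_{x_t}\pi_t(x_t)P_t(x_{t+1}\mid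 x_t,u_t)$ and $\xi_t(x_t\mid\pi_t,\sigma_t,m_t)=\pi_t(x_t)\sigma_t(m_t\mid x_t)/\sum_{\tilde x_t}\pi_t(\tilde x_t)\sigma_t(m_t\mid\tilde x_t)$, which is taken to be the uniform distribution if the denominator is zero. The *canonical beliefs* are $\pi_1^A=\hat\pi$, $\pi_t^B=\xi_t(\pi_t^A,\sigma_t,m_t)$, $\pi_{t+1}^A=\ell_t(\pi_t^B,u_t)$. A *canonical-belief-based (CBB)* strategy is a family of maps $\lambda_t^A:\Delta(\mathcal X_t)\to\mathcal S_t$ (respectively $\lambda_t^B:\Delta(\mathcal X_t)\to\mathcal U_t$), played as $g_t^i(h_t^i)=\lambda_t^i(\pi_t^i)$. An experiment $\sigma_t$ *induces* the finitely supported measure $\eta$ on $\Delta(\mathcal X_t)$ *from* $\pi_t$ if $\eta(\tilde\pi)=\sum_{m}\mathbf 1\{\tilde\pi=\xi_t(\pi_t,\sigma_t,m)\}\sum_{x}\sigma_t(m\mid x)\pi_t(x)$ for all $\tilde\pi\in\Delta(\mathcal X_t)$. A *triangulation* $\gamma$ of $\Delta(\mathcal X_t)$ is a finite set of simplices with union $\Delta(\mathcal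 X_t)$, containing the faces of its members, any two of which meet in a (possibly empty) common face. Every $\pi\in\Delta(\mathcal X_t)$ is in exactly one way a convex combination of the vertices of one simplex of $\gamma$; $\mathbb C(\pi,\gamma)$ is this convex combination, seen as a finitely supported measure, and $\mathbb I(f,\gamma)(\pi)=\int f\,\mathrm d\mathbb C(\pi,\gamma)$. The concave closure of $f:\Delta(\mathcal X_t)\to\mathbb R$ is $\mathrm{cav}(f)(\omega)=\sup\{z:(\omega,z)\in\mathrm{conv}(\mathrm{graph} f)\}$, and $\arg\mathrm{cav}(f)$ is the set of triangulations $\gamma$ with $\mathbb I(f,\gamma)=\mathrm{cav}(f)$. **Theorem.** Let $V_{T+1}^A=V_{T+1}^B=0$ and, for $t=T,\dots,1$ and $\pi_t\in\Delta(\mathcal X_t)$, $$\hat q_t^i(\pi_t,u_t)=\sum_{x_t}r_t^i(x_t,u_t)\pi_t(x_t)+V_{t+1}^i(\ell_t(\pi_t,u_t)),\quad i\in\{A,B\},$$ $$\Upsilon_t(\pi_t)=\arg\max_{u_t}\hat q_t^B(\pi_t,u_t),\quad \hat v_t^A(\pi_t)=\max_{u_t\in\Upsilon_t(\pi_t)}\hat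 q_t^A(\pi_t,u_t),\quad \hat v_t^B(\pi_t)=\max_{u_t}\hat q_t^B(\pi_t,u_t),$$ $$\gamma_t\in\arg\mathrm{cav}(\hat v_t^A),\qquad V_t^i=\mathbb I(\hat v_t^i,\gamma_t),\quad i\in\{A,B\}.$$ Let $\lambda_t^{*B}(\pi_t)$ be any $u_t\in\Upsilon_t(\pi_t)$ that attains the maximum defining $\hat v_t^A(\pi_t)$, and let $\lambda_t^{*A}(\pi_t)$ be any experiment that induces $\mathbb C(\pi_t,\gamma_t)$ from $\pi_t$. Then the CBB strategies $(\lambda^{*A},\lambda^{*B})$ form the strategy part of a PBE, i.e. there is a belief system $\mu$ that makes them a PBE, and the payoffs of the principal and the receiver in it are $V_1^A(\hat\pi)$ and $V_1^B(\hat\pi)$. -/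

import Mathlib

noncomputable section

open scoped Classical

namespace SignalPicking

universe u v w

/-! ### Distributions on finite sets, finitely supported measures -/

/-- `Δ(Ω)`: probability distributions on a finite set `Ω`. -/
abbrev Distr (Ω : Type*) [Fintype Ω] : Type _ := stdSimplex ℝ Ω

/-- The integral `∫ f dν` of a real function against a finitely supported measure. -/
def integral {α : Type*} (f : α → ℝ) (ν : α →₀ ℝ) : ℝ :=
  Finsupp.linearCombination ℝ f ν

/-- The image of a finitely supported measure `ν` on `α` under a finitely supported kernel `K`,
i.e. `∑ a, ν a • K a`. -/
def push {α β : Type*} (K : α → (β →₀ ℝ)) (ν : α →₀ ℝ) : β →₀ ℝ :=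
  Finsupp.linearCombination ℝ K ν

/-! ### Triangulations of `Δ(X)`, interpolation, concave closure -/

section Geometry

variable {X : Type*} [Fintype X]

/-- A triangulation of the polytope `Δ(X)`: a finite simplicial complex (each simplex being given
by its affinely independent set of vertices) whose simplices cover `Δ(X)` exactly. -/
structure Triangulation (X : Type*) [Fintype X] where
  complex : Geometry.SimplicialComplex ℝ (X → ℝ)
  finite : complex.faces.Finite
  space_eq : complex.space = stdSimplex ℝ X

/-- `η` is a convex combination of the vertices of one simplex of `γ` which represents `π`. -/
def Represents (γ : Triangulation X) (π : Distr X) (η : Distr X →₀ ℝ) : Prop :=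
  (∀ p, 0 ≤ η p) ∧ (∑ p ∈ η.support, η p = 1) ∧
  (∑ p ∈ η.support, η p • (p : X → ℝ) = (π : X → ℝ)) ∧
  ∃ s ∈ γ.complex.faces, ∀ p ∈ η.support, (p : X → ℝ) ∈ s

theorem weights_unique {E : Type*} [AddCommGroup E] [Module ℝ E] {s : Finset E}
    (hs : AffineIndependent ℝ ((↑) : s → E)) (a b : E → ℝ)
    (hsum : ∑ x ∈ s, a x = ∑ x ∈ s, b x) (hbar : ∑ x ∈ s, a x • x = ∑ x ∈ s, b x • x) :
    ∀ x ∈ s, a x = b x := by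
  intro x hx
  have h := affineIndependent_iff.1 hs Finset.univ (fun i => a i - b i)
    (by
      rw [Finset.sum_sub_distrib, Finset.sum_coe_sort s a, Finset.sum_coe_sort s b, hsum, sub_self])
    (by
      simp only [sub_smul]
      rw [Finset.sum_sub_distrib, Finset.sum_coe_sort s (fun x => a x • x),
        Finset.sum_coe_sort s (fun x => b x • x), hbar, sub_self])
    ⟨x, hx⟩ (Finset.mem_univ _)
  exact sub_eq_zero.1 h

/-- The weight that `η` gives to a point of the ambient space. -/
def ambientWeight (η : Distr X →₀ ℝ) (e : X → ℝ) : ℝ :=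
  if h : e ∈ stdSimplex ℝ X then η ⟨e, h⟩ else 0

theorem ambientWeight_coe (η : Distr X →₀ ℝ) (p : Distr X) :
    ambientWeight η (p : X → ℝ) = η p := by
  have h : (p : X → ℝ) ∈ stdSimplex ℝ X := p.2
  unfold ambientWeight
  rw [dif_pos h]
  rfl

theorem ambientWeight_sum {F : Type*} [AddCommGroup F] [Module ℝ F] (η : Distr X →₀ ℝ)
    (s : Finset (X → ℝ)) (hs : ∀ p ∈ η.support, (p : X → ℝ) ∈ s) (f : (X → ℝ) → F) :
    ∑ e ∈ s, ambientWeight η e • f e = ∑ p ∈ η.support, η p • f p := by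
  symm
  refine Finset.sum_of_injOn (fun p : Distr X => (p : X → ℝ)) ?_ ?_ ?_ ?_
  · intro p _ q _ h
    exact DFunLike.coe_injective h
  · intro p hp
    exact hs p hp
  · intro e _ hne
    unfold ambientWeight
    split_ifs with h
    · have : η ⟨e, h⟩ = 0 := by
        by_contra h0
        exact hne ⟨⟨e, h⟩, Finsupp.mem_support_iff.2 h0, rfl⟩
      rw [this, zero_smul]
    · rw [zero_smul]
  · intro p _
    simp only [ambientWeight_coe]

/-- Every point of `Δ(X)` is in a unique way a convex combination of the vertices of one simplex
of the triangulation. -/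
theorem existsUnique_represents (γ : Triangulation X) (π : Distr X) :
    ∃! η, Represents γ π η := by
  have hmem : (π : X → ℝ) ∈ γ.complex.space := by rw [γ.space_eq]; exact π.2
  obtain ⟨s, hs, hπ⟩ := Geometry.SimplicialComplex.mem_space_iff.1 hmem
  refine existsUnique_of_exists_of_unique ?_ ?_
  · have hsub : ∀ e ∈ s, e ∈ stdSimplex ℝ X := fun e he => by
      rw [← γ.space_eq]; exact γ.complex.subset_space hs he
    obtain ⟨a, ha0, ha1, hac⟩ := Finset.mem_convexHull'.1 hπ
    let η : Distr X →₀ ℝ := Finsupp.onFinset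
      (s.attach.image fun e => (⟨e.1, hsub e.1 e.2⟩ : Distr X))
      (fun p => if (p : X → ℝ) ∈ s then a p else 0)
      (by
        intro p hp
        have hps : (p : X → ℝ) ∈ s := by by_contra h; exact hp (if_neg h)
        exact Finset.mem_image.2 ⟨⟨_, hps⟩, Finset.mem_attach _ _, rfl⟩)
    have hη : ∀ p, η p = if (p : X → ℝ) ∈ s then a p else 0 := fun p => rfl
    have hsupp : ∀ p ∈ η.support, (p : X → ℝ) ∈ s := by
      intro p hp
      by_contra h
      exact Finsupp.mem_support_iff.1 hp (by rw [hη, if_neg h])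
    have hw : ∀ e ∈ s, ambientWeight η e = a e := by
      intro e he
      have := ambientWeight_coe η ⟨e, hsub e he⟩
      rw [hη, if_pos (show ((⟨e, hsub e he⟩ : Distr X) : X → ℝ) ∈ s from he)] at this
      exact this
    refine ⟨η, ?_, ?_, ?_, s, hs, hsupp⟩
    · intro p
      rw [hη]
      split_ifs with h
      · exact ha0 _ h
      · exact le_rfl
    · have := ambientWeight_sum η s hsupp (fun _ => (1 : ℝ))
      simp only [smul_eq_mul, mul_one] at this
      rw [← this, Finset.sum_congr rfl hw, ha1]
    · have := ambientWeight_sum η s hsupp (fun e => e)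
      rw [← this, Finset.sum_congr rfl (fun e he => by rw [hw e he]), hac]
  · -- two representations live on a common face
    have key : ∀ η, Represents γ π η → ∀ t ∈ γ.complex.faces, (π : X → ℝ) ∈ convexHull ℝ (t : Set (X → ℝ)) →
        ∀ p ∈ η.support, (p : X → ℝ) ∈ t := by
      rintro η ⟨h0, h1, hb, r, hr, hrs⟩ t ht hπt p hp
      have hπr : (π : X → ℝ) ∈ convexHull ℝ (r : Set (X → ℝ)) := by
        rw [← hb]
        exact (convex_convexHull ℝ _).sum_mem (fun p _ => h0 p) h1
          (fun p hp => subset_convexHull ℝ _ (hrs p hp))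
      have hint := γ.complex.inter_subset_convexHull hr ht ⟨hπr, hπt⟩
      rw [← Finset.coe_inter] at hint
      obtain ⟨b, -, hb1, hbc⟩ := Finset.mem_convexHull'.1 hint
      have hu := weights_unique (γ.complex.indep hr) (ambientWeight η)
        (fun e => if e ∈ t then b e else 0)
        (by
          have := ambientWeight_sum η r hrs (fun _ => (1 : ℝ))
          simp only [smul_eq_mul, mul_one] at this
          rw [this, h1, ← Finset.sum_filter, Finset.filter_mem_eq_inter, hb1])
        (by
          rw [ambientWeight_sum η r hrs (fun e => e), hb]
          simp only [ite_smul, zero_smul]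
          rw [← Finset.sum_filter, Finset.filter_mem_eq_inter, hbc])
        p (hrs p hp)
      rw [ambientWeight_coe] at hu
      by_contra h
      exact Finsupp.mem_support_iff.1 hp (by rw [hu, if_neg h])
    intro η η' hη hη'
    have e1 := key η hη s hs hπ
    have e2 := key η' hη' s hs hπ
    obtain ⟨-, h1, hb, -⟩ := hη
    obtain ⟨-, h1', hb', -⟩ := hη'
    have hu := weights_unique (γ.complex.indep hs) (ambientWeight η) (ambientWeight η')
      (by
        have a1 := ambientWeight_sum η s e1 (fun _ => (1 : ℝ))
        have a2 := ambientWeight_sum η' s e2 (fun _ => (1 : ℝ))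
        simp only [smul_eq_mul, mul_one] at a1 a2
        rw [a1, a2, h1, h1'])
      (by rw [ambientWeight_sum η s e1 (fun e => e), ambientWeight_sum η' s e2 (fun e => e), hb, hb'])
    ext p
    by_cases hp : (p : X → ℝ) ∈ s
    · simpa only [ambientWeight_coe] using hu p hp
    · have z1 : η p = 0 := by
        by_contra h
        exact hp (e1 p (Finsupp.mem_support_iff.2 h))
      have z2 : η' p = 0 := by
        by_contra h
        exact hp (e2 p (Finsupp.mem_support_iff.2 h))
      rw [z1, z2]

/-- `ℂ(π, γ)`: the finite measure given by the unique representation of `π` as a convex combination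
of the vertices of one simplex of `γ`. -/
def combMeasure (π : Distr X) (γ : Triangulation X) : Distr X →₀ ℝ :=
  (existsUnique_represents γ π).choose

/-- `𝕀(f, γ)`: the interpolation of `f` based on the triangulation `γ`. -/
def interp (f : Distr X → ℝ) (γ : Triangulation X) (π : Distr X) : ℝ :=
  integral f (combMeasure π γ)

/-- The concave closure of `f`: `cav(f)(ω) = sup {z : (ω, z) ∈ conv (graph f)}`. -/
def cav (f : Distr X → ℝ) (ω : Distr X) : ℝ :=
  sSup {z : ℝ | ((ω : X → ℝ), z) ∈
    convexHull ℝ (Set.range fun p : Distr X => ((p : X → ℝ), f p))}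

/-- The triangulations of `Δ(X)` on which the interpolation of `f` is its concave closure. -/
def argcav (f : Distr X → ℝ) : Set (Triangulation X) :=
  {γ | interp f γ = cav f}

end Geometry

/-! ### The signal picking game -/

/-- The two players: the principal `A` and the receiver `B`. -/
inductive Player : Type
  | A
  | B

/-- The data of a signal picking game with `T` stages, numbered `0, …, T - 1`. At stage `t` the
state lies in `X t`, the receiver acts in `U t` and experiments have outcomes in `M t`. -/
structure Game (X : ℕ → Type u) (U : ℕ → Type v) (M : ℕ → Type w) [∀ t, Fintype (X t)] where
  /-- number of stages -/
  T : ℕ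
  /-- prior distribution of the initial state -/
  prior : Distr (X 0)
  /-- transition kernels -/
  P : ∀ t, X t → U t → Distr (X (t + 1))
  /-- instantaneous rewards -/
  r : Player → ∀ t, X t → U t → ℝ

/-- The space `𝒮` of experiments for a state space `X` and an outcome space `M`. -/
abbrev Experiment (X : Type*) (M : Type*) [Fintype M] : Type _ := X → Distr M

/-- State trajectories `x_0, …, x_t`. -/
def Path (X : ℕ → Type u) : ℕ → Type u
  | 0 => X 0
  | t + 1 => Path X t × X (t + 1)

instance instFintypePath (X : ℕ → Type u) [∀ t, Fintype (X t)] : ∀ t, Fintype (Path X t)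
  | 0 => inferInstanceAs (Fintype (X 0))
  | t + 1 =>
    haveI := instFintypePath X t
    inferInstanceAs (Fintype (Path X t × X (t + 1)))

/-- The current state `x_t` of a trajectory. -/
def Path.last {X : ℕ → Type u} : ∀ {t : ℕ}, Path X t → X t
  | 0, x => x
  | _ + 1, x => x.2

section Histories

variable (X : ℕ → Type u) (U : ℕ → Type v) (M : ℕ → Type w) [∀ t, Fintype (M t)]

/-- The principal's histories at stage `t`: experiments, outcomes and actions of all stages
before `t`. -/
def HistA : ℕ → Type (max u v w)
  | 0 => PUnit
  | t + 1 => (HistA t × Experiment (X t) (M t) × M t) × U t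

/-- The receiver's histories at stage `t`: the principal's history followed by the experiment of
stage `t` and its outcome. -/
abbrev HistB (t : ℕ) : Type (max u v w) := HistA X U M t × Experiment (X t) (M t) × M t

/-- Pure strategy profiles. -/
structure Profile where
  A : ∀ t, HistA X U M t → Experiment (X t) (M t)
  B : ∀ t, HistB X U M t → U t

/-- Belief systems: at each information set, a distribution of the state trajectory so far. -/
structure Beliefs [∀ t, Fintype (X t)] where
  A : ∀ t, HistA X U M t → Distr (Path X t)
  B : ∀ t, HistB X U M t → Distr (Path X t)

end Histories

/-! ### Bayesian update and induced distributions -/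

section Update

variable {X M : Type*} [Fintype X] [Fintype M]

/-- The probability of outcome `m` of the experiment `σ` under `π`. -/
def outcomeProb (π : Distr X) (σ : Experiment X M) (m : M) : ℝ := ∑ x, π x * σ x m

theorem outcomeProb_nonneg (π : Distr X) (σ : Experiment X M) (m : M) :
    0 ≤ outcomeProb π σ m :=
  Finset.sum_nonneg fun x _ => mul_nonneg (π.2.1 x) ((σ x).2.1 m)

/-- The Bayesian update `ξ`; it is the uniform distribution if the outcome has probability `0`. -/
def xi [Nonempty X] (π : Distr X) (σ : Experiment X M) (m : M) : Distr X :=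
  if h : outcomeProb π σ m ≠ 0 then
    ⟨fun x => π x * σ x m / outcomeProb π σ m,
      fun x => div_nonneg (mul_nonneg (π.2.1 x) ((σ x).2.1 m)) (outcomeProb_nonneg π σ m),
      by rw [← Finset.sum_div]; exact div_self h⟩
  else
    ⟨fun _ => (Fintype.card X : ℝ)⁻¹, fun _ => by positivity, by simp⟩

/-- The experiment `σ` induces the finitely supported distribution `η` from `π`. -/
def Induces [Nonempty X] (σ : Experiment X M) (η : Distr X →₀ ℝ) (π : Distr X) : Prop :=
  ∀ p : Distr X, η p = ∑ m, if p = xi π σ m then outcomeProb π σ m else 0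

end Update

namespace Game

variable {X : ℕ → Type u} {U : ℕ → Type v} {M : ℕ → Type w}
  [∀ t, Fintype (X t)] [∀ t, Fintype (M t)]

/-! ### Laws of the play and payoffs -/

section Play

variable (G : Game X U M)

/-- First half of stage `t` under `g`: the experiment prescribed by `g` is carried out. -/
def stepM (g : Profile X U M) (t : ℕ) (z : Path X t × HistA X U M t) :
    (Path X t × HistB X U M t) →₀ ℝ :=
  ∑ m : M t, Finsupp.single (z.1, (z.2, g.A t z.2, m)) (g.A t z.2 z.1.last m)

/-- Second half of stage `t` under `g`: the receiver acts as prescribed by `g` and the state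
moves on. -/
def stepX (g : Profile X U M) (t : ℕ) (z : Path X t × HistB X U M t) :
    (Path X (t + 1) × HistA X U M (t + 1)) →₀ ℝ :=
  ∑ x' : X (t + 1), Finsupp.single ((z.1, x'), (z.2, g.B t z.2))
    (G.P t z.1.last (g.B t z.2) x')

/-- `Pr^g(x_{0:t}, h_t^A)` as a finitely supported measure. -/
def lawA (g : Profile X U M) : ∀ t, (Path X t × HistA X U M t) →₀ ℝ
  | 0 => ∑ x : X 0, Finsupp.single ((x, PUnit.unit) : Path X 0 × HistA X U M 0) (G.prior x)
  | t + 1 => push (G.stepX g t) (push (stepM g t) (lawA g t))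

/-- `Pr^g(x_{0:t}, h_t^B)` as a finitely supported measure. -/
def lawB (g : Profile X U M) (t : ℕ) : (Path X t × HistB X U M t) →₀ ℝ :=
  push (stepM g t) (G.lawA g t)

/-- Reward of player `i` at stage `t`, when the receiver plays according to `g`. -/
def stageReward (i : Player) (g : Profile X U M) (t : ℕ) (z : Path X t × HistB X U M t) : ℝ :=
  G.r i t z.1.last (g.B t z.2)

/-- `J^i(g) = E^g[∑_{t < T} r_t^i(X_t, U_t)]`. -/
def payoff (i : Player) (g : Profile X U M) : ℝ :=
  ∑ t ∈ Finset.range G.T, integral (G.stageReward i g t) (G.lawB g t)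

/-- The expectation of `∑_{t ≤ s < T} r_s^i(X_s, U_s)` when `ν` is the joint law of the state
trajectory and the receiver's history at stage `t` and `g` is played from then on. -/
def contPayoff (i : Player) (g : Profile X U M) (t : ℕ)
    (ν : (Path X t × HistB X U M t) →₀ ℝ) : ℝ :=
  if t < G.T then
    integral (G.stageReward i g t) ν +
      contPayoff i g (t + 1) (push (stepM g (t + 1)) (push (G.stepX g t) ν))
  else 0
termination_by G.T - t

/-- The expectation of `∑_{t ≤ s < T} r_s^A(X_s, U_s)` for the principal at the history `h`, with
belief `b` on the state trajectory, if `g` is played from then on. -/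
def contA (g : Profile X U M) (t : ℕ) (h : HistA X U M t) (b : Distr (Path X t)) : ℝ :=
  G.contPayoff Player.A g t
    (push (stepM g t) (∑ x : Path X t, Finsupp.single (x, h) (b x)))

/-- The expectation of `∑_{t ≤ s < T} r_s^B(X_s, U_s)` for the receiver at the history `h`, with
belief `b` on the state trajectory, if `g` is played from then on. -/
def contB (g : Profile X U M) (t : ℕ) (h : HistB X U M t) (b : Distr (Path X t)) : ℝ :=
  G.contPayoff Player.B g t (∑ x : Path X t, Finsupp.single (x, h) (b x))

/-! ### Perfect Bayesian equilibrium -/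

/-- Sequential rationality of `g` given `μ`: at every history (reached or not) each player's
strategy is optimal among all strategies, given the belief there and the other's strategy. -/
def SequentiallyRational (g : Profile X U M) (μ : Beliefs X U M) : Prop :=
  (∀ t < G.T, ∀ (h : HistA X U M t) (a : ∀ s, HistA X U M s → Experiment (X s) (M s)),
    G.contA { g with A := a } t h (μ.A t h) ≤ G.contA g t h (μ.A t h)) ∧
  (∀ t < G.T, ∀ (h : HistB X U M t) (b : ∀ s, HistB X U M s → U s),
    G.contB { g with B := b } t h (μ.B t h) ≤ G.contB g t h (μ.B t h))

/-- At every history of positive probability under `g`, the belief is the conditional law of the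
state trajectory. -/
def Consistent (g : Profile X U M) (μ : Beliefs X U M) : Prop :=
  (∀ t < G.T, ∀ h : HistA X U M t, 0 < ∑ y, G.lawA g t (y, h) →
    ∀ x, μ.A t h x = G.lawA g t (x, h) / ∑ y, G.lawA g t (y, h)) ∧
  (∀ t < G.T, ∀ h : HistB X U M t, 0 < ∑ y, G.lawB g t (y, h) →
    ∀ x, μ.B t h x = G.lawB g t (x, h) / ∑ y, G.lawB g t (y, h))

/-- From each history to the next one, on and off the path of play, beliefs are updated by Bayes'
law whenever the denominator is non-zero. (The prescribed move does not enter, since it is a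
function of the public history; the update after an action has denominator `1`.) -/
def BayesUpdated (μ : Beliefs X U M) : Prop :=
  (∀ (h : HistA X U M 0) (x : X 0), μ.A 0 h x = G.prior x) ∧
  (∀ t < G.T, ∀ (h : HistA X U M t) (σ : Experiment (X t) (M t)) (m : M t),
    ∑ y, μ.A t h y * σ y.last m ≠ 0 →
      ∀ x, μ.B t (h, σ, m) x = μ.A t h x * σ x.last m / ∑ y, μ.A t h y * σ y.last m) ∧
  (∀ t, t + 1 < G.T → ∀ (h : HistB X U M t) (a : U t) (x : Path X t) (x' : X (t + 1)),
    μ.A (t + 1) (h, a) (x, x') = μ.B t h x * G.P t x.last a x')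

/-- `(g, μ)` is a Perfect Bayesian Equilibrium. -/
structure IsPBE (g : Profile X U M) (μ : Beliefs X U M) : Prop where
  rational : G.SequentiallyRational g μ
  consistent : G.Consistent g μ
  bayes : G.BayesUpdated μ

end Play

/-! ### Canonical beliefs and canonical-belief-based strategies -/

section Canonical

variable (G : Game X U M)

/-- The prediction `ℓ_t(π, u)` of the next state. -/
def ell (t : ℕ) (π : Distr (X t)) (a : U t) : Distr (X (t + 1)) :=
  ⟨fun x' => ∑ x, π x * G.P t x a x',
    fun x' => Finset.sum_nonneg fun x _ => mul_nonneg (π.2.1 x) ((G.P t x a).2.1 x'),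
    by
      rw [Finset.sum_comm]
      have h : ∀ x, ∑ x', π x * G.P t x a x' = π x := fun x => by
        rw [← Finset.mul_sum, show ∑ x', G.P t x a x' = 1 from (G.P t x a).2.2, mul_one]
      rw [Finset.sum_congr rfl fun x _ => h x]
      exact π.2.2⟩

variable [∀ t, Nonempty (X t)]

/-- The canonical belief `κ_t^A` of the principal. -/
def kappaA : ∀ t, HistA X U M t → Distr (X t)
  | 0, _ => G.prior
  | t + 1, h => G.ell t (xi (kappaA t h.1.1) h.1.2.1 h.1.2.2) h.2

/-- The canonical belief `κ_t^B` of the receiver. -/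
def kappaB (t : ℕ) (h : HistB X U M t) : Distr (X t) :=
  xi (G.kappaA t h.1) h.2.1 h.2.2

/-- The strategy profile in which the players use the canonical-belief-based strategies
`lamA`, `lamB`. -/
def cbb (lamA : ∀ t, Distr (X t) → Experiment (X t) (M t)) (lamB : ∀ t, Distr (X t) → U t) :
    Profile X U M where
  A t h := lamA t (G.kappaA t h)
  B t h := lamB t (G.kappaB t h)

end Canonical

/-! ### The backward induction -/

section DynamicProgramming

variable (G : Game X U M)

/-- One stage of the recursion, `W` being the value functions of the next stage:
`∑ x, r_t^i(x, u) π(x) + W^i(ℓ_t(π, u))`. -/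
def stageQ (t : ℕ) (W : Player → Distr (X (t + 1)) → ℝ) (i : Player) (π : Distr (X t))
    (a : U t) : ℝ :=
  ∑ x, G.r i t x a * π x + W i (G.ell t π a)

/-- The receiver's best responses `argmax_u` of the receiver's Q-function. -/
def stageBest (t : ℕ) (W : Player → Distr (X (t + 1)) → ℝ) (π : Distr (X t)) : Set (U t) :=
  {a | ∀ a', G.stageQ t W Player.B π a' ≤ G.stageQ t W Player.B π a}

/-- `v̂_t^A` is the maximum of the principal's Q-function over the receiver's best responses,
`v̂_t^B` is the maximum of the receiver's Q-function over all actions. (Action sets are finite and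
non-empty, so both suprema are maxima.) -/
def stageV (t : ℕ) (W : Player → Distr (X (t + 1)) → ℝ) : Player → Distr (X t) → ℝ
  | Player.A, π => sSup (G.stageQ t W Player.A π '' G.stageBest t W π)
  | Player.B, π => sSup (Set.range (G.stageQ t W Player.B π))

/-- The value functions `V_t^i` for given triangulations: `V_T = 0`, and `V_t^i` is the
interpolation of `v̂_t^i` on `γ_t`. -/
def V (γ : ∀ t, Triangulation (X t)) (t : ℕ) : Player → Distr (X t) → ℝ :=
  if t < G.T then fun i => interp (G.stageV t (V γ (t + 1)) i) (γ t) else fun _ _ => 0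
termination_by G.T - t

/-- `q̂_t^i(π, u)`. -/
def qHat (γ : ∀ t, Triangulation (X t)) (t : ℕ) : Player → Distr (X t) → U t → ℝ :=
  G.stageQ t (G.V γ (t + 1))

/-- `Υ_t(π)`. -/
def Upsilon (γ : ∀ t, Triangulation (X t)) (t : ℕ) : Distr (X t) → Set (U t) :=
  G.stageBest t (G.V γ (t + 1))

/-- `v̂_t^i(π)`. -/
def vHat (γ : ∀ t, Triangulation (X t)) (t : ℕ) : Player → Distr (X t) → ℝ :=
  G.stageV t (G.V γ (t + 1))

end DynamicProgramming

end Game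

end SignalPicking

end

/-! Canonical beliefs are functions of the public history alone, on and off the path, so a deviation
does not alter how they react to a history. Against a canonical-belief-based opponent, each player
thus faces a Markov decision problem with the canonical belief as state, and the theorem is a
dynamic-programming verification. `verification` is the common argument: one-stage inequalities
against `V` and `vHat` accumulate, by backward induction, to inequalities for continuation payoffs
at every history. Both signs together evaluate the prescribed profile exactly; one sign bounds a
deviation.

For the principal, the posteriors of any experiment average to the prior, so the expected `vHat` is
at most its concave closure (`sum_outcomeProb_mul_le_cav`), which the prescribed splitting attains.
For the receiver, no action beats the maximum, and the prescribed splitting yields the interpolated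
value exactly (`Induces.integral_eq`), whether or not it serves the receiver. Tie-breaking in the
principal's favour lets one action attain both `vHat`s.

A PBE needs beliefs on whole trajectories. `pathBeliefs` applies Bayes' law to trajectories and,
after an impossible outcome, lifts the canonical posterior. Its current-state marginals are the
canonical beliefs, and continuation payoffs depend on nothing else. The law of play under any
profile is a mixture of these beliefs over histories (`exists_lawA_eq`), whence consistency. -/

noncomputable section

open scoped Classical

namespace SignalPicking

universe u v w

/-! ### Finitely supported measures, kernels and slices -/

section FiniteMeasures

variable {α β δ : Type*}

theorem integral_add (f : α → ℝ) (μ ν : α →₀ ℝ) :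
    integral f (μ + ν) = integral f μ + integral f ν := map_add _ _ _

theorem integral_sum {ι : Type*} (f : α → ℝ) (s : Finset ι) (ν : ι → α →₀ ℝ) :
    integral f (∑ i ∈ s, ν i) = ∑ i ∈ s, integral f (ν i) := map_sum _ _ _

theorem integral_single (f : α → ℝ) (a : α) (c : ℝ) :
    integral f (Finsupp.single a c) = c * f a := by
  simp [integral]

theorem push_add (K : α → (β →₀ ℝ)) (μ ν : α →₀ ℝ) :
    push K (μ + ν) = push K μ + push K ν := map_add _ _ _

theorem push_sum {ι : Type*} (K : α → (β →₀ ℝ)) (s : Finset ι) (ν : ι → α →₀ ℝ) :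
    push K (∑ i ∈ s, ν i) = ∑ i ∈ s, push K (ν i) := map_sum _ _ _

theorem push_single (K : α → (β →₀ ℝ)) (a : α) (c : ℝ) :
    push K (Finsupp.single a c) = c • K a := by
  simp [push]

theorem push_single_one (K : α → (β →₀ ℝ)) (a : α) : push K (Finsupp.single a 1) = K a := by
  rw [push_single, one_smul]

theorem push_push (K : α → (β →₀ ℝ)) (L : β → (δ →₀ ℝ)) (ν : α →₀ ℝ) :
    push L (push K ν) = push (fun a => push L (K a)) ν := by
  simp only [push, Finsupp.linearCombination_apply, Finsupp.sum, map_sum, map_smul]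

/-- The measure with density `b` on the slice of all pairs with second component `h`. -/
def slice [Fintype α] (h : β) (b : α → ℝ) : (α × β) →₀ ℝ :=
  ∑ x, Finsupp.single (x, h) (b x)

theorem slice_smul [Fintype α] (h : β) (c : ℝ) (b : α → ℝ) :
    slice h (fun x => c * b x) = c • slice h b := by
  simp [slice, Finset.smul_sum]

theorem integral_slice [Fintype α] (f : α × β → ℝ) (h : β) (b : α → ℝ) :
    integral f (slice h b) = ∑ x, b x * f (x, h) := by
  simp only [slice, integral_sum, integral_single]

theorem push_slice [Fintype α] (K : α × β → (δ →₀ ℝ)) (h : β) (b : α → ℝ) :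
    push K (slice h b) = ∑ x, b x • K (x, h) := by
  simp only [slice, push_sum, push_single]

theorem slice_apply [Fintype α] (h h' : β) (b : α → ℝ) (x : α) :
    slice h b (x, h') = if h = h' then b x else 0 := by
  simp only [slice, Finsupp.finsetSum_apply, Finsupp.single_apply, Prod.mk.injEq]
  by_cases hh : h = h' <;> simp [hh]

/-- Disintegration: `w` is the weight of the histories and `b h` the conditional density given `h`.
-/
theorem push_slice_apply [Fintype α] (b : β → α → ℝ) (w : β →₀ ℝ) (x : α) (h : β) :
    push (fun h => slice h (b h)) w (x, h) = w h * b h x := by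
  simp only [push, Finsupp.linearCombination_apply, Finsupp.sum, Finsupp.finsetSum_apply,
    Finsupp.smul_apply, slice_apply, smul_eq_mul, mul_ite, mul_zero, Finset.sum_ite_eq',
    Finsupp.mem_support_iff]
  by_cases hw : w h = 0 <;> simp [hw]

end FiniteMeasures

/-! ### Upper bounds for interpolations and concave closures -/

section ConcaveClosure

variable {Y : Type*} [Fintype Y]

theorem interp_le {f : Distr Y → ℝ} {C : ℝ} (hf : ∀ p, f p ≤ C) (γ : Triangulation Y)
    (π : Distr Y) : interp f γ π ≤ C := by
  obtain ⟨h0, h1, -⟩ := (existsUnique_represents γ π).choose_spec.1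
  change integral f (existsUnique_represents γ π).choose ≤ C
  generalize (existsUnique_represents γ π).choose = η at h0 h1
  calc integral f η = ∑ p ∈ η.support, η p * f p := rfl
    _ ≤ ∑ p ∈ η.support, η p * C :=
        Finset.sum_le_sum fun p _ => mul_le_mul_of_nonneg_left (hf p) (h0 p)
    _ = C := by rw [← Finset.sum_mul, h1, one_mul]

/-- The bound on `f` is what makes the supremum genuine: the graph, hence its convex hull, lies in
the half-space below height `C`. A real `sSup` of an unbounded set would be the default value 0. -/
theorem le_cav {f : Distr Y → ℝ} {C : ℝ} (hf : ∀ p, f p ≤ C) (π : Distr Y) {z : ℝ}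
    (hz : ((π : Y → ℝ), z) ∈ convexHull ℝ (Set.range fun p : Distr Y => ((p : Y → ℝ), f p))) :
    z ≤ cav f π := by
  refine le_csSup ⟨C, ?_⟩ hz
  intro z' hz'
  have hconv : Convex ℝ {q : (Y → ℝ) × ℝ | q.2 ≤ C} :=
    convex_halfSpace_le (LinearMap.snd ℝ (Y → ℝ) ℝ).isLinear C
  have hsub : Set.range (fun p : Distr Y => ((p : Y → ℝ), f p)) ⊆ {q | q.2 ≤ C} := by
    rintro _ ⟨p, rfl⟩
    exact hf p
  exact convexHull_min hsub hconv hz'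

end ConcaveClosure

/-! ### Posteriors of an experiment -/

section BayesUpdate

variable {Y O : Type*} [Fintype Y] [Fintype O]

theorem sum_outcomeProb (π : Distr Y) (σ : Experiment Y O) : ∑ m, outcomeProb π σ m = 1 := by
  simp only [outcomeProb]
  rw [Finset.sum_comm, ← show ∑ x, π x = 1 from π.2.2]
  refine Finset.sum_congr rfl fun x _ => ?_
  rw [← Finset.mul_sum, show ∑ m, σ x m = 1 from (σ x).2.2, mul_one]

variable [Nonempty Y]

/-- Bayes' law without division. An outcome of probability zero has all its summands zero, so the
convention for `xi` there is immaterial. -/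
theorem outcomeProb_mul_xi (π : Distr Y) (σ : Experiment Y O) (m : O) (x : Y) :
    outcomeProb π σ m * xi π σ m x = π x * σ x m := by
  by_cases h : outcomeProb π σ m = 0
  · rw [h, zero_mul]
    exact ((Finset.sum_eq_zero_iff_of_nonneg
      (fun x _ => mul_nonneg (π.2.1 x) ((σ x).2.1 m))).1 h x (Finset.mem_univ x)).symm
  · rw [xi, dif_pos h]
    exact mul_div_cancel₀ _ h

/-- Posteriors average to the prior, so the expected pair of posterior and value is a point over `π`
in the convex hull of the graph. -/
theorem sum_outcomeProb_mul_le_cav {f : Distr Y → ℝ} {C : ℝ} (hf : ∀ p, f p ≤ C) (π : Distr Y)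
    (σ : Experiment Y O) : ∑ m, outcomeProb π σ m * f (xi π σ m) ≤ cav f π := by
  refine le_cav hf π ?_
  have h := (convex_convexHull ℝ
    (Set.range fun p : Distr Y => ((p : Y → ℝ), f p))).sum_mem (t := Finset.univ)
    (w := outcomeProb π σ) (z := fun m => ((xi π σ m : Y → ℝ), f (xi π σ m)))
    (fun m _ => outcomeProb_nonneg π σ m) (sum_outcomeProb π σ)
    (fun m _ => subset_convexHull ℝ _ ⟨xi π σ m, rfl⟩)
  convert h using 1
  refine Prod.ext ?_ ?_
  · ext x
    simp only [Prod.fst_sum, Finset.sum_apply, Prod.smul_fst, Pi.smul_apply, smul_eq_mul,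
      outcomeProb_mul_xi]
    rw [← Finset.mul_sum, show ∑ m, σ x m = 1 from (σ x).2.2, mul_one]
  · simp [Prod.snd_sum]

/-- Distinct outcomes may share a posterior; as a sum of point masses, the induced measure merges
them automatically. -/
theorem Induces.integral_eq {σ : Experiment Y O} {η : Distr Y →₀ ℝ} {π : Distr Y}
    (h : Induces σ η π) (f : Distr Y → ℝ) :
    integral f η = ∑ m, outcomeProb π σ m * f (xi π σ m) := by
  have hη : η = ∑ m, Finsupp.single (xi π σ m) (outcomeProb π σ m) := by
    ext p
    rw [h p, Finsupp.finsetSum_apply]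
    refine Finset.sum_congr rfl fun m _ => ?_
    rw [Finsupp.single_apply]
    exact if_congr eq_comm rfl rfl
  rw [hη, integral_sum]
  simp only [integral_single]

end BayesUpdate

/-! ### Trajectories and their current-state marginals -/

section Paths

variable {X : ℕ → Type u}

theorem Path.last_surjective [∀ t, Nonempty (X t)] :
    ∀ t, Function.Surjective (Path.last : Path X t → X t)
  | 0, x => ⟨x, rfl⟩
  | t + 1, x => by
    obtain ⟨y, -⟩ := Path.last_surjective t (Classical.arbitrary (X t))
    exact ⟨(y, x), rfl⟩

variable [∀ t, Fintype (X t)]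

theorem sum_path_succ {R : Type*} [AddCommMonoid R] {t : ℕ} (f : Path X (t + 1) → R) :
    ∑ z, f z = ∑ y : Path X t, ∑ x : X (t + 1), f (y, x) :=
  Fintype.sum_prod_type (α₁ := Path X t) (α₂ := X (t + 1)) f

/-- The marginal of `b` on the current state is `c • π`. -/
def HasLast {t : ℕ} (b : Path X t → ℝ) (c : ℝ) (π : Distr (X t)) : Prop :=
  ∀ f : X t → ℝ, ∑ y, b y * f y.last = c * ∑ x, π x * f x

/-- Leaving the belief unnormalized turns conditioning into multiplication; the outcome's
probability moves into the total mass. -/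
theorem HasLast.update [∀ t, Nonempty (X t)] {t : ℕ} {b : Path X t → ℝ} {c : ℝ}
    {π : Distr (X t)} (hb : HasLast b c π) {O : Type*} [Fintype O] (σ : Experiment (X t) O)
    (m : O) :
    HasLast (fun y => b y * σ y.last m) (c * outcomeProb π σ m) (xi π σ m) := by
  intro f
  have h := hb fun x => σ x m * f x
  simp only [mul_assoc] at h ⊢
  rw [h, Finset.mul_sum (a := outcomeProb π σ m)]
  simp only [← mul_assoc, outcomeProb_mul_xi]

/-- A distribution on trajectories whose current state has distribution `π`. -/
def liftLast [∀ t, Nonempty (X t)] {t : ℕ} (π : Distr (X t)) : Distr (Path X t) :=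
  stdSimplex.map (Function.surjInv (Path.last_surjective t)) π

theorem hasLast_liftLast [∀ t, Nonempty (X t)] {t : ℕ} (π : Distr (X t)) :
    HasLast (liftLast π : Path X t → ℝ) 1 π := by
  intro f
  rw [one_mul, liftLast, stdSimplex.map_coe]
  simp only [FunOnFinite.linearMap_apply_apply, Finset.sum_mul]
  -- Group the states by the trajectory chosen for each; that trajectory ends in the state it was
  -- chosen for.
  rw [← Finset.sum_fiberwise Finset.univ (Function.surjInv (Path.last_surjective t))
    (fun x => π x * f x)]
  refine Finset.sum_congr rfl fun y _ => Finset.sum_congr rfl fun x hx => ?_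
  have hy : Path.last y = x := by
    rw [← (Finset.mem_filter.1 hx).2]
    exact Function.surjInv_eq (Path.last_surjective t) x
  rw [hy]

end Paths

namespace Game

variable {X : ℕ → Type u} {U : ℕ → Type v} {M : ℕ → Type w}
  [∀ t, Fintype (X t)]

/-! ### Recursive form of continuation payoffs -/

section Recursion

variable [∀ t, Fintype (M t)] (G : Game X U M) (i : Player) (g : Profile X U M)

theorem push_stepM_slice (t : ℕ) (h : HistA X U M t) (b : Path X t → ℝ) :
    push (stepM g t) (slice h b) =
      ∑ m, slice ((h, g.A t h, m) : HistB X U M t) fun y => b y * g.A t h y.last m := by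
  rw [push_slice]
  simp only [stepM, slice, Finset.smul_sum, Finsupp.smul_single, smul_eq_mul]
  exact Finset.sum_comm

theorem push_stepX_slice (t : ℕ) (h : HistB X U M t) (b : Path X t → ℝ) :
    push (G.stepX g t) (slice h b) =
      slice ((h, g.B t h) : HistA X U M (t + 1))
        fun z : Path X (t + 1) => b z.1 * G.P t z.1.last (g.B t h) z.2 := by
  rw [push_slice]
  simp only [slice, sum_path_succ, stepX, Finset.smul_sum, Finsupp.smul_single, smul_eq_mul]
  rfl

theorem contPayoff_of_lt {t : ℕ} (ht : t < G.T) (ν : (Path X t × HistB X U M t) →₀ ℝ) :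
    G.contPayoff i g t ν = integral (G.stageReward i g t) ν +
      G.contPayoff i g (t + 1) (push (stepM g (t + 1)) (push (G.stepX g t) ν)) := by
  rw [contPayoff, if_pos ht]

theorem contPayoff_of_le {t : ℕ} (ht : G.T ≤ t) (ν : (Path X t × HistB X U M t) →₀ ℝ) :
    G.contPayoff i g t ν = 0 := by
  rw [contPayoff, if_neg (not_lt.2 ht)]

/-- Backward induction over the stages of the game. -/
theorem backward_induction {C : ℕ → Prop} (T : ℕ) (hT : ∀ t, T ≤ t → C t)
    (hs : ∀ t < T, C (t + 1) → C t) (t : ℕ) : C t := by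
  -- `n` bounds the number of stages left; `n = T` serves every `t`.
  have key : ∀ n t, T ≤ t + n → C t := by
    intro n
    induction n with
    | zero => exact fun t ht => hT t ht
    | succ n ih =>
      intro t ht
      rcases lt_or_ge t T with h | h
      · exact hs t h (ih (t + 1) (by omega))
      · exact hT t h
  exact key T t (by omega)

theorem contPayoff_add (t : ℕ) : ∀ μ ν : (Path X t × HistB X U M t) →₀ ℝ,
    G.contPayoff i g t (μ + ν) = G.contPayoff i g t μ + G.contPayoff i g t ν := by
  induction t using backward_induction G.T with
  | hT t ht => intro μ ν; simp [contPayoff_of_le G i g ht]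
  | hs t ht ih =>
    intro μ ν
    simp only [contPayoff_of_lt G i g ht, integral_add, push_add, ih]
    ring

theorem contPayoff_sum (t : ℕ) {ι : Type*} (s : Finset ι)
    (ν : ι → (Path X t × HistB X U M t) →₀ ℝ) :
    G.contPayoff i g t (∑ j ∈ s, ν j) = ∑ j ∈ s, G.contPayoff i g t (ν j) :=
  map_sum (AddMonoidHom.mk' (G.contPayoff i g t) (contPayoff_add G i g t)) ν s

/-- Payoff of player `i` from stage `t` on, for an unnormalized belief `b` at a history of the
principal. -/
def valueA (t : ℕ) (h : HistA X U M t) (b : Path X t → ℝ) : ℝ :=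
  G.contPayoff i g t (push (stepM g t) (slice h b))

/-- Payoff of player `i` from stage `t` on, for an unnormalized belief `b` at a history of the
receiver. -/
def valueB (t : ℕ) (h : HistB X U M t) (b : Path X t → ℝ) : ℝ :=
  G.contPayoff i g t (slice h b)

/-- With `valueB_eq`, this is the Bellman recursion for a fixed profile. Unnormalized beliefs absorb
the outcome probabilities, so no case of a null outcome arises. -/
theorem valueA_eq_sum (t : ℕ) (h : HistA X U M t) (b : Path X t → ℝ) :
    G.valueA i g t h b =
      ∑ m, G.valueB i g t (h, g.A t h, m) fun y => b y * g.A t h y.last m := by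
  rw [valueA, push_stepM_slice, contPayoff_sum]
  rfl

theorem valueB_eq {t : ℕ} (ht : t < G.T) (h : HistB X U M t) (b : Path X t → ℝ) :
    G.valueB i g t h b = ∑ y, b y * G.r i t y.last (g.B t h) +
      G.valueA i g (t + 1) (h, g.B t h)
        fun z : Path X (t + 1) => b z.1 * G.P t z.1.last (g.B t h) z.2 := by
  rw [valueB, contPayoff_of_lt G i g ht, integral_slice, push_stepX_slice]
  rfl

theorem valueA_of_le {t : ℕ} (ht : G.T ≤ t) (h : HistA X U M t) (b : Path X t → ℝ) :
    G.valueA i g t h b = 0 := contPayoff_of_le G i g ht _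

theorem contPayoff_lawB (t : ℕ) : G.contPayoff i g t (G.lawB g t) =
    ∑ s ∈ Finset.Ico t G.T, integral (G.stageReward i g s) (G.lawB g s) := by
  induction t using backward_induction G.T with
  | hT t ht => simp [contPayoff_of_le G i g ht, Finset.Ico_eq_empty_of_le ht]
  | hs t ht ih =>
    rw [contPayoff_of_lt G i g ht, Finset.sum_eq_sum_Ico_succ_bot ht, ← ih]
    rfl

theorem payoff_eq_valueA : G.payoff i g = G.valueA i g 0 PUnit.unit (G.prior : X 0 → ℝ) := by
  rw [payoff, Finset.range_eq_Ico, ← contPayoff_lawB]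
  rfl

end Recursion

/-! ### Value functions and the verification argument -/

section Values

variable (G : Game X U M) (γ : ∀ t, Triangulation (X t))

theorem V_of_lt {t : ℕ} (ht : t < G.T) (i : Player) :
    G.V γ t i = interp (G.vHat γ t i) (γ t) := by
  rw [V, if_pos ht]
  rfl

theorem V_of_le {t : ℕ} (ht : G.T ≤ t) (i : Player) (π : Distr (X t)) : G.V γ t i π = 0 := by
  rw [V, if_neg (not_lt.2 ht)]

theorem exists_stageV_le [∀ t, Fintype (U t)] {t : ℕ} {W : Player → Distr (X (t + 1)) → ℝ}
    {C : ℝ} (hC : 0 ≤ C) (hW : ∀ i π, W i π ≤ C) :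
    ∃ C' : ℝ, 0 ≤ C' ∧ ∀ i π, G.stageV t W i π ≤ C' := by
  -- Summing over both players, all actions and all states gives one constant valid for every
  -- reward, whichever the player.
  refine ⟨∑ a, ∑ x, (|G.r Player.A t x a| + |G.r Player.B t x a|) + C, by positivity, ?_⟩
  have hq : ∀ i π a, G.stageQ t W i π a ≤
      ∑ a, ∑ x, (|G.r Player.A t x a| + |G.r Player.B t x a|) + C := by
    intro i π a
    refine add_le_add ?_ (hW _ _)
    refine le_trans (Finset.sum_le_sum (g := fun x =>
      |G.r Player.A t x a| + |G.r Player.B t x a|) fun x _ => ?_)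
      (Finset.single_le_sum (f := fun a => ∑ x, (|G.r Player.A t x a| + |G.r Player.B t x a|))
        (fun a _ => by positivity) (Finset.mem_univ a))
    have h0 : 0 ≤ π x := π.2.1 x
    have h1 : π x ≤ 1 := stdSimplex.le_one π x
    have h2 : |G.r i t x a| ≤ |G.r Player.A t x a| + |G.r Player.B t x a| := by
      cases i <;> simp
    calc G.r i t x a * π x ≤ |G.r i t x a| * π x :=
          mul_le_mul_of_nonneg_right (le_abs_self _) h0
      _ ≤ |G.r i t x a| * 1 := mul_le_mul_of_nonneg_left h1 (abs_nonneg _)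
      _ ≤ _ := by rw [mul_one]; exact h2
  intro i π
  cases i
  -- A nonnegative bound also covers the default value 0 of an empty supremum, so best responses
  -- need not be shown to exist here.
  · refine Real.sSup_le ?_ (by positivity)
    rintro _ ⟨a, -, rfl⟩
    exact hq _ _ _
  · refine Real.sSup_le ?_ (by positivity)
    rintro _ ⟨a, rfl⟩
    exact hq _ _ _

theorem exists_V_le [∀ t, Fintype (U t)] (t : ℕ) :
    ∃ C : ℝ, 0 ≤ C ∧ ∀ i π, G.V γ t i π ≤ C := by
  induction t using backward_induction G.T with
  | hT t ht => exact ⟨0, le_rfl, fun i π => (V_of_le G γ ht i π).le⟩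
  | hs t ht ih =>
    obtain ⟨C, hC, hV⟩ := ih
    obtain ⟨C', hC', hv⟩ := G.exists_stageV_le hC hV
    refine ⟨C', hC', fun i π => ?_⟩
    rw [V_of_lt G γ ht]
    exact interp_le (hv i) _ _

theorem exists_vHat_le [∀ t, Fintype (U t)] (t : ℕ) :
    ∃ C : ℝ, ∀ i π, G.vHat γ t i π ≤ C := by
  obtain ⟨C, hC, hV⟩ := G.exists_V_le γ (t + 1)
  obtain ⟨C', -, hv⟩ := G.exists_stageV_le hC hV
  exact ⟨C', hv⟩

theorem qHat_le_vHat_B [∀ t, Fintype (U t)] (t : ℕ) (π : Distr (X t)) (a : U t) :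
    G.qHat γ t Player.B π a ≤ G.vHat γ t Player.B π :=
  le_csSup (Set.finite_range _).bddAbove ⟨a, rfl⟩

theorem qHat_eq_vHat_B_of_mem_Upsilon {t : ℕ} {π : Distr (X t)} {a : U t}
    (ha : a ∈ G.Upsilon γ t π) : G.qHat γ t Player.B π a = G.vHat γ t Player.B π := by
  have hmax : IsGreatest (Set.range (G.qHat γ t Player.B π)) (G.qHat γ t Player.B π a) := by
    refine ⟨⟨a, rfl⟩, ?_⟩
    rintro _ ⟨a', rfl⟩
    exact ha a'
  exact hmax.csSup_eq.symm

/-- The transition depends on the trajectory only through its last state, so the marginal alone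
determines the prediction; the mass is unchanged. -/
theorem hasLast_ell {t : ℕ} {b : Path X t → ℝ} {c : ℝ} {π : Distr (X t)} (hb : HasLast b c π)
    (a : U t) :
    HasLast (fun z : Path X (t + 1) => b z.1 * G.P t z.1.last a z.2) c (G.ell t π a) := by
  intro f
  have h := hb fun x => ∑ x', G.P t x a x' * f x'
  rw [sum_path_succ]
  simp only [Finset.mul_sum, ← mul_assoc] at h
  simp only [Path.last] at h ⊢
  rw [h, Finset.sum_comm, Finset.mul_sum]
  refine Finset.sum_congr rfl fun x' _ => ?_
  rw [show G.ell t π a x' = ∑ x, π x * G.P t x a x' from rfl, Finset.sum_mul, Finset.mul_sum]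
  simp only [mul_assoc]

variable [∀ t, Nonempty (X t)] [∀ t, Fintype (M t)]

/-- If `V` and `vHat` dominate (with the sign `s`) the one-stage values under `g`, they dominate
the payoffs under `g`. -/
theorem verification (i : Player) (g : Profile X U M) (s : ℝ)
    (hA : ∀ t < G.T, ∀ h : HistA X U M t,
      s * ∑ m, outcomeProb (G.kappaA t h) (g.A t h) m *
        G.vHat γ t i (xi (G.kappaA t h) (g.A t h) m) ≤ s * G.V γ t i (G.kappaA t h))
    (hB : ∀ t < G.T, ∀ h : HistB X U M t,
      s * G.qHat γ t i (G.kappaB t h) (g.B t h) ≤ s * G.vHat γ t i (G.kappaB t h)) :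
    (∀ t (h : HistA X U M t) b c, 0 ≤ c → HasLast b c (G.kappaA t h) →
      s * G.valueA i g t h b ≤ s * (c * G.V γ t i (G.kappaA t h))) ∧
    (∀ t < G.T, ∀ (h : HistB X U M t) b c, 0 ≤ c → HasLast b c (G.kappaB t h) →
      s * G.valueB i g t h b ≤ s * (c * G.vHat γ t i (G.kappaB t h))) := by
  -- Kept separate from the induction because it serves twice: inside the inductive step and for the
  -- second conclusion.
  have stepB : ∀ t < G.T,
      (∀ (h : HistA X U M (t + 1)) b c, 0 ≤ c → HasLast b c (G.kappaA (t + 1) h) →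
        s * G.valueA i g (t + 1) h b ≤ s * (c * G.V γ (t + 1) i (G.kappaA (t + 1) h))) →
      ∀ (h : HistB X U M t) b c, 0 ≤ c → HasLast b c (G.kappaB t h) →
        s * G.valueB i g t h b ≤ s * (c * G.vHat γ t i (G.kappaB t h)) := by
    intro t ht ih h b c hc hb
    have h1 := ih (h, g.B t h) _ c hc (G.hasLast_ell hb (g.B t h))
    have h2 := mul_le_mul_of_nonneg_left (hB t ht h) hc
    have h3 : G.qHat γ t i (G.kappaB t h) (g.B t h) =
        ∑ x, G.r i t x (g.B t h) * G.kappaB t h x +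
          G.V γ (t + 1) i (G.kappaA (t + 1) (h, g.B t h)) := rfl
    have h4 := hb fun x => G.r i t x (g.B t h)
    simp only [mul_comm (G.kappaB t h _)] at h4
    rw [valueB_eq G i g ht, h4]
    rw [h3] at h2
    linarith
  have stepA : ∀ t (h : HistA X U M t) b c, 0 ≤ c → HasLast b c (G.kappaA t h) →
      s * G.valueA i g t h b ≤ s * (c * G.V γ t i (G.kappaA t h)) := by
    intro t
    induction t using backward_induction G.T with
    | hT t ht =>
      intro h b c _ _
      rw [valueA_of_le G i g ht, V_of_le G γ ht, mul_zero, mul_zero, mul_zero]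
    | hs t ht ih =>
      intro h b c hc hb
      rw [valueA_eq_sum, Finset.mul_sum]
      refine (Finset.sum_le_sum fun m _ => stepB t ht ih (h, g.A t h, m) _ _
        (mul_nonneg hc (outcomeProb_nonneg _ _ _)) (hb.update (g.A t h) m)).trans ?_
      have h2 := mul_le_mul_of_nonneg_left (hA t ht h) hc
      refine le_trans (le_of_eq ?_) (h2.trans (le_of_eq (by ring)))
      rw [Finset.mul_sum, Finset.mul_sum]
      refine Finset.sum_congr rfl fun m _ => ?_
      rw [kappaB]
      ring
  exact ⟨stepA, fun t ht => stepB t ht (stepA (t + 1))⟩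

end Values

/-! ### A consistent belief system extending the canonical beliefs -/

section PathBeliefs

variable [∀ t, Fintype (M t)] (G : Game X U M)

theorem outcomeProb_of_hasLast {t : ℕ} {b : Path X t → ℝ} {π : Distr (X t)}
    (hb : HasLast b 1 π) (σ : Experiment (X t) (M t)) (m : M t) :
    ∑ y, b y * σ y.last m = outcomeProb π σ m := by
  simpa [outcomeProb] using hb fun x => σ x m

/-- Bayesian update of a belief on trajectories; if the outcome is impossible, an arbitrary belief
under which the current state has distribution `π`. -/
def updatePath [∀ t, Nonempty (X t)] {t : ℕ} (b : Distr (Path X t)) (π : Distr (X t))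
    (σ : Experiment (X t) (M t)) (m : M t) : Distr (Path X t) :=
  if h : ∑ y, b y * σ y.last m ≠ 0 then
    ⟨fun y => b y * σ y.last m / ∑ y, b y * σ y.last m,
      fun y => div_nonneg (mul_nonneg (b.2.1 y) ((σ y.last).2.1 m))
        (Finset.sum_nonneg fun y _ => mul_nonneg (b.2.1 y) ((σ y.last).2.1 m)),
      by rw [← Finset.sum_div]; exact div_self h⟩
  else liftLast π

/-- Prediction of the trajectory up to the next stage. -/
def extendPath {t : ℕ} (b : Distr (Path X t)) (a : U t) : Distr (Path X (t + 1)) :=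
  ⟨fun z => b z.1 * G.P t z.1.last a z.2,
    fun z => mul_nonneg (b.2.1 z.1) ((G.P t z.1.last a).2.1 z.2),
    by
      rw [sum_path_succ]
      simp only [← Finset.mul_sum]
      rw [← show ∑ y, b y = 1 from b.2.2]
      refine Finset.sum_congr rfl fun y _ => ?_
      rw [show ∑ x', G.P t y.last a x' = 1 from (G.P t y.last a).2.2, mul_one]⟩

variable [∀ t, Nonempty (X t)]

/-- Beliefs of the principal on trajectories that extend the canonical beliefs. -/
def pathBeliefA : ∀ t, HistA X U M t → Distr (Path X t)
  | 0, _ => G.prior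
  | t + 1, h => G.extendPath
      (updatePath (pathBeliefA t h.1.1) (G.kappaB t h.1) h.1.2.1 h.1.2.2) h.2

/-- Beliefs of the receiver on trajectories that extend the canonical beliefs. -/
def pathBeliefB (t : ℕ) (h : HistB X U M t) : Distr (Path X t) :=
  updatePath (G.pathBeliefA t h.1) (G.kappaB t h) h.2.1 h.2.2

/-- The belief system on trajectories that extends the canonical beliefs. -/
def pathBeliefs : Beliefs X U M where
  A := G.pathBeliefA
  B := G.pathBeliefB

/-- Whether an outcome is impossible depends only on the marginal, so both updates divide by the
same number, and in the impossible case `liftLast` restores the canonical posterior. -/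
theorem hasLast_updatePath {t : ℕ} {b : Distr (Path X t)} {π : Distr (X t)}
    (hb : HasLast (b : Path X t → ℝ) 1 π) (σ : Experiment (X t) (M t)) (m : M t) :
    HasLast (updatePath b (xi π σ m) σ m : Path X t → ℝ) 1 (xi π σ m) := by
  by_cases h : ∑ y, b y * σ y.last m = 0
  · rw [updatePath, dif_neg (not_not.2 h)]
    exact hasLast_liftLast _
  · intro f
    have hu := hb.update σ m f
    rw [one_mul, ← outcomeProb_of_hasLast hb] at hu
    rw [updatePath, dif_pos h]
    change ∑ y, b y * σ y.last m / (∑ y, b y * σ y.last m) * f y.last = _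
    simp only [div_mul_eq_mul_div]
    rw [← Finset.sum_div, hu, mul_div_cancel_left₀ _ h, one_mul]

theorem hasLast_pathBeliefA : ∀ (t : ℕ) (h : HistA X U M t),
    HasLast (G.pathBeliefA t h : Path X t → ℝ) 1 (G.kappaA t h)
  | 0, _ => fun _ => (one_mul _).symm
  | t + 1, h => G.hasLast_ell
      (hasLast_updatePath (hasLast_pathBeliefA t h.1.1) h.1.2.1 h.1.2.2) h.2

theorem hasLast_pathBeliefB (t : ℕ) (h : HistB X U M t) :
    HasLast (G.pathBeliefB t h : Path X t → ℝ) 1 (G.kappaB t h) :=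
  hasLast_updatePath (G.hasLast_pathBeliefA t h.1) h.2.1 h.2.2

theorem sum_mul_updatePath {t : ℕ} (b : Distr (Path X t)) (π : Distr (X t))
    (σ : Experiment (X t) (M t)) (m : M t) (y : Path X t) :
    (∑ z, b z * σ z.last m) * updatePath b π σ m y = b y * σ y.last m := by
  by_cases h : ∑ y, b y * σ y.last m = 0
  · rw [h, zero_mul]
    exact ((Finset.sum_eq_zero_iff_of_nonneg
      (fun y _ => mul_nonneg (b.2.1 y) ((σ y.last).2.1 m))).1 h y (Finset.mem_univ y)).symm
  · rw [updatePath, dif_pos h]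
    exact mul_div_cancel₀ _ h

theorem bayesUpdated_pathBeliefs : G.BayesUpdated G.pathBeliefs := by
  refine ⟨fun _ _ => rfl, ?_, fun _ _ _ _ _ _ => rfl⟩
  intro t _ h σ m hne x
  exact eq_div_of_mul_eq hne ((mul_comm _ _).trans
    (sum_mul_updatePath (G.pathBeliefA t h) _ σ m x))

/-- The prescribed experiment is a function of the public history, so choosing it carries no
information about the states; only the outcome reweights the slice, and its probability becomes the
weight of the new history. -/
theorem push_stepM_push_slice (g : Profile X U M) (t : ℕ) (w : HistA X U M t →₀ ℝ) :
    ∃ w' : HistB X U M t →₀ ℝ,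
      push (stepM g t) (push (fun h => slice h (G.pathBeliefA t h : Path X t → ℝ)) w) =
        push (fun h => slice h (G.pathBeliefB t h : Path X t → ℝ)) w' := by
  refine ⟨push (fun h => ∑ m, Finsupp.single (h, g.A t h, m)
    (∑ y, G.pathBeliefA t h y * g.A t h y.last m)) w, ?_⟩
  rw [push_push, push_push]
  congr 1
  funext h
  rw [push_stepM_slice, push_sum]
  refine Finset.sum_congr rfl fun m _ => ?_
  rw [push_single, ← slice_smul]
  congr 1
  funext y
  exact (sum_mul_updatePath (G.pathBeliefA t h) _ _ m y).symm

/-- The same beliefs serve every profile: strategies affect only the weights of the histories. -/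
theorem exists_lawA_eq (g : Profile X U M) : ∀ t, ∃ w : HistA X U M t →₀ ℝ,
    G.lawA g t = push (fun h => slice h (G.pathBeliefA t h : Path X t → ℝ)) w
  | 0 => ⟨Finsupp.single PUnit.unit 1, (push_single_one (fun h => slice h (G.pathBeliefA 0 h : Path X 0 → ℝ)) PUnit.unit).symm⟩
  | t + 1 => by
    obtain ⟨w, hw⟩ := exists_lawA_eq g t
    obtain ⟨w', hw'⟩ := G.push_stepM_push_slice g t w
    refine ⟨push (fun h => Finsupp.single (h, g.B t h) 1) w', ?_⟩
    rw [lawA, hw, hw', push_push, push_push]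
    congr 1
    funext h
    exact (push_stepX_slice G g t h _).trans (push_single_one
      (fun h => slice h (G.pathBeliefA (t + 1) h : Path X (t + 1) → ℝ)) _).symm

/-- Each `b h` has mass one, so summing out the first component recovers the weight `w h`. -/
theorem eq_div_of_push_slice {α β : Type*} [Fintype α] {b : β → Distr α} {w : β →₀ ℝ}
    {ν : (α × β) →₀ ℝ} (hν : ν = push (fun h => slice h (b h : α → ℝ)) w) {h : β}
    (hpos : 0 < ∑ y, ν (y, h)) (x : α) : b h x = ν (x, h) / ∑ y, ν (y, h) := by
  have hsum : ∑ y, ν (y, h) = w h := by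
    simp only [hν, push_slice_apply]
    rw [← Finset.mul_sum, show ∑ y, b h y = 1 from (b h).2.2, mul_one]
  rw [hsum] at hpos ⊢
  rw [hν, push_slice_apply, mul_div_cancel_left₀ _ hpos.ne']

theorem consistent_pathBeliefs (g : Profile X U M) : G.Consistent g G.pathBeliefs := by
  refine ⟨fun t _ h hpos x => ?_, fun t _ h hpos x => ?_⟩
  · obtain ⟨w, hw⟩ := G.exists_lawA_eq g t
    exact eq_div_of_push_slice hw hpos x
  · obtain ⟨w, hw⟩ := G.exists_lawA_eq g t
    obtain ⟨w', hw'⟩ := G.push_stepM_push_slice g t w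
    have hB : G.lawB g t = push (fun h => slice h (G.pathBeliefB t h : Path X t → ℝ)) w' := by
      rw [lawB, hw, hw']
    exact eq_div_of_push_slice hB hpos x

end PathBeliefs

end Game

end SignalPicking

end

/-! ### Equilibrium and payoffs -/

open SignalPicking in
theorem theorem1 {X : ℕ → Type*} {U : ℕ → Type*} {M : ℕ → Type*}
    [∀ t, Fintype (X t)] [∀ t, Nonempty (X t)]
    [∀ t, Fintype (U t)] [∀ t, Nonempty (U t)] [∀ t, Fintype (M t)]
    (G : Game X U M) (γ : ∀ t, Triangulation (X t))
    (hγ : ∀ t < G.T, γ t ∈ argcav (G.vHat γ t Player.A))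
    (lamA : ∀ t, Distr (X t) → Experiment (X t) (M t))
    (hlamA : ∀ t < G.T, ∀ π : Distr (X t), Induces (lamA t π) (combMeasure π (γ t)) π)
    (lamB : ∀ t, Distr (X t) → U t)
    (hlamB : ∀ t < G.T, ∀ π : Distr (X t),
      lamB t π ∈ G.Upsilon γ t π ∧ G.qHat γ t Player.A π (lamB t π) = G.vHat γ t Player.A π) :
    (∃ μ : Beliefs X U M, G.IsPBE (G.cbb lamA lamB) μ) ∧
    G.payoff Player.A (G.cbb lamA lamB) = G.V γ 0 Player.A G.prior ∧
    G.payoff Player.B (G.cbb lamA lamB) = G.V γ 0 Player.B G.prior := by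
  have eqA : ∀ i, ∀ t < G.T, ∀ π : Distr (X t),
      ∑ m, outcomeProb π (lamA t π) m * G.vHat γ t i (xi π (lamA t π) m) = G.V γ t i π := by
    intro i t ht π
    rw [G.V_of_lt γ ht, ← (hlamA t ht π).integral_eq]
    rfl
  have eqB : ∀ i, ∀ t < G.T, ∀ π : Distr (X t),
      G.qHat γ t i π (lamB t π) = G.vHat γ t i π := by
    intro i t ht π
    cases i
    · exact (hlamB t ht π).2
    · exact G.qHat_eq_vHat_B_of_mem_Upsilon γ (hlamB t ht π).1
  -- The only place where the triangulation has to realize the concave closure.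
  have leA : ∀ t < G.T, ∀ (π : Distr (X t)) (σ : Experiment (X t) (M t)),
      ∑ m, outcomeProb π σ m * G.vHat γ t Player.A (xi π σ m) ≤ G.V γ t Player.A π := by
    intro t ht π σ
    obtain ⟨C, hC⟩ := G.exists_vHat_le γ t
    have hcav : interp (G.vHat γ t Player.A) (γ t) = cav (G.vHat γ t Player.A) := hγ t ht
    rw [G.V_of_lt γ ht, hcav]
    exact sum_outcomeProb_mul_le_cav (hC Player.A) π σ
  -- The one-stage relations are equalities here, hence hold for either sign `s`; `s = 1` and `s =
  -- -1` pin the values down.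
  have bound : ∀ i s, _ := fun i s => G.verification γ i (G.cbb lamA lamB) s
    (fun t ht h => (congrArg (s * ·) (eqA i t ht (G.kappaA t h))).le)
    (fun t ht h => (congrArg (s * ·) (eqB i t ht (G.kappaB t h))).le)
  have exactA : ∀ i t (h : HistA X U M t) b, HasLast b 1 (G.kappaA t h) →
      G.valueA i (G.cbb lamA lamB) t h b = G.V γ t i (G.kappaA t h) := by
    intro i t h b hb
    have h1 := (bound i 1).1 t h b 1 zero_le_one hb
    have h2 := (bound i (-1)).1 t h b 1 zero_le_one hb
    linarith
  have exactB : ∀ i, ∀ t < G.T, ∀ (h : HistB X U M t) b, HasLast b 1 (G.kappaB t h) →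
      G.valueB i (G.cbb lamA lamB) t h b = G.vHat γ t i (G.kappaB t h) := by
    intro i t ht h b hb
    have h1 := (bound i 1).2 t ht h b 1 zero_le_one hb
    have h2 := (bound i (-1)).2 t ht h b 1 zero_le_one hb
    linarith
  have pay : ∀ i, G.payoff i (G.cbb lamA lamB) = G.V γ 0 i G.prior := fun i => by
    rw [G.payoff_eq_valueA]
    exact exactA i 0 PUnit.unit _ (G.hasLast_pathBeliefA 0 PUnit.unit)
  refine ⟨⟨G.pathBeliefs, ⟨?_, ?_⟩, G.consistent_pathBeliefs _, G.bayesUpdated_pathBeliefs⟩,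
    pay _, pay _⟩
  · intro t _ h a
    have hb := G.hasLast_pathBeliefA t h
    -- The deviating experiments enter the histories, hence the canonical beliefs, to which the
    -- receiver still responds by `lamB`.
    have hdev := (G.verification γ Player.A { G.cbb lamA lamB with A := a } 1
      (fun t ht h => mul_le_mul_of_nonneg_left (leA t ht _ _) zero_le_one)
      (fun t ht h => (congrArg (1 * ·) (eqB _ t ht (G.kappaB t h))).le)).1 t h _ 1 zero_le_one hb
    simp only [one_mul] at hdev
    exact hdev.trans (exactA Player.A t h _ hb).ge
  · intro t ht h b
    have hb := G.hasLast_pathBeliefB t h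
    -- Roles are reversed: the principal's splitting is exact for the receiver's values, and the
    -- deviating action is at most maximal.
    have hdev := (G.verification γ Player.B { G.cbb lamA lamB with B := b } 1
      (fun t ht h => (congrArg (1 * ·) (eqA _ t ht (G.kappaA t h))).le)
      (fun t ht h => mul_le_mul_of_nonneg_left (G.qHat_le_vHat_B γ t _ _) zero_le_one)).2
      t ht h _ 1 zero_le_one hb
    simp only [one_mul] at hdev
    exact hdev.trans (exactB Player.B t ht h _ hb).ge
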